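/- Let $G$ be a Lie group of dimension $n$ with identity $e$, and let $m$ be a bi-invariant Riemannian metric on $G$, that is, a smooth Riemannian metric for which all left translations and all right translations are isometries. Let $X$ be a left-invariant vector field on $G$, and let $\exp : T_eG \to G$ be the exponential map of the Lie group: $\exp(tX(e)) = \Phi(t,X)$, where $t \mapsto \Phi(t,X)$ is the integral curve of $X$ with $\Phi(0,X)=e$. Then for every $g \in G$ the curve $\gamma(t) = g\,\exp(tX(e))$, $t \in \mathbb{R}$, is a geodesic of $(G,m)$ with $\gamma(0)=g$. That is, $\gamma$ is smooth and $\nabla_{\dot\gamma}\dot\gamma = 0$ for the Levi-Civita connection $\nabla$ of $m$; equivalently, in every chart of $G$, at all times $t$ at which $\gamma(t)$ lies in its domain, $$\ddot\gamma_i + \sum_{j,k=1}^n \Gamma^i_{jk}\,\dot\gamma_j\dot\gamma_k = 0 \quad (i=1,\dots,n), \qquad \Gamma^i_{jk} = \frac12\sum_{l=1}^n m^{il}\left(\frac{\partial m_{jl}}{\partial x_k}+\frac{\partial m_{kl}}{\partial x_j}-\frac{\partial m_{jk}}{\partial x_l}\right),$$ where $(m_{ij})$ is the matrix of $m$ in the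 chart and $(m^{ij})$ its inverse. -/

import Mathlib

open scoped Manifold ContDiff
open Bundle

noncomputable section

namespace LieGeodesic

/-! ### Riemannian metrics in charts, the Levi-Civita connection and geodesics -/

section Riemannian

variable {n : ℕ} {M : Type*} [TopologicalSpace M] [ChartedSpace (EuclideanSpace ℝ (Fin n)) M]
  [IsManifold (𝓡 n) ∞ M]

/-- A smooth Riemannian metric on a smooth manifold `M` of dimension `n`. -/
abbrev RiemannianMetricOn (n : ℕ) (M : Type*) [TopologicalSpace M]
    [ChartedSpace (EuclideanSpace ℝ (Fin n)) M] [IsManifold (𝓡 n) ∞ M] : Type _ :=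
  ContMDiffRiemannianMetric (𝓡 n) ∞ (EuclideanSpace ℝ (Fin n))
    (fun x : M => TangentSpace (𝓡 n) x)

/-- The `i`-th vector of the standard basis of `ℝⁿ`. -/
abbrev stdVec {n : ℕ} (i : Fin n) : EuclideanSpace ℝ (Fin n) := EuclideanSpace.single i (1 : ℝ)

/-- The coordinate vector field `∂/∂xᵢ` of the chart `e`, at the point with coordinates `y`. -/
def coordVec (e : OpenPartialHomeomorph M (EuclideanSpace ℝ (Fin n))) (i : Fin n)
    (y : EuclideanSpace ℝ (Fin n)) : TangentSpace (𝓡 n) (e.symm y) :=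
  mfderiv (𝓡 n) (𝓡 n) e.symm y (stdVec i)

/-- The matrix `(g_{ij})` of the metric in the chart `e`, at the point with coordinates `y`. -/
def metricMatrix (g : RiemannianMetricOn n M)
    (e : OpenPartialHomeomorph M (EuclideanSpace ℝ (Fin n)))
    (y : EuclideanSpace ℝ (Fin n)) : Matrix (Fin n) (Fin n) ℝ :=
  Matrix.of fun i j => g.inner (e.symm y) (coordVec e i y) (coordVec e j y)

/-- `g_{ij,k} = ∂g_{ij}/∂x_k`, in the chart `e`. -/
def metricPartial (g : RiemannianMetricOn n M)
    (e : OpenPartialHomeomorph M (EuclideanSpace ℝ (Fin n)))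
    (i j k : Fin n) (y : EuclideanSpace ℝ (Fin n)) : ℝ :=
  fderiv ℝ (fun z => metricMatrix g e z i j) y (stdVec k)

/-- The Christoffel symbol `Γⁱ_{jk}` of the Levi-Civita connection in the chart `e`. -/
def christoffel (g : RiemannianMetricOn n M)
    (e : OpenPartialHomeomorph M (EuclideanSpace ℝ (Fin n)))
    (i j k : Fin n) (y : EuclideanSpace ℝ (Fin n)) : ℝ :=
  (1 / 2 : ℝ) * ∑ l, (metricMatrix g e y)⁻¹ i l *
    (metricPartial g e j l k y + metricPartial g e k l j y - metricPartial g e j k l y)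

/-- The `i`-th component, in the chart `e`, of the covariant acceleration `∇_{γ'} γ'` of the
curve `γ` at time `t`, for the Levi-Civita connection `∇`. -/
def covariantAcceleration (g : RiemannianMetricOn n M)
    (e : OpenPartialHomeomorph M (EuclideanSpace ℝ (Fin n))) (γ : ℝ → M) (i : Fin n) (t : ℝ) : ℝ :=
  deriv (deriv fun s => e (γ s) i) t +
    ∑ j, ∑ k, christoffel g e i j k (e (γ t)) *
      deriv (fun s => e (γ s) j) t * deriv (fun s => e (γ s) k) t

/-- A curve `γ : ℝ → M` is a geodesic if it is smooth and `∇_{γ'} γ' = 0`, that is, the geodesic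
equation holds at all times and in every chart of the smooth structure. -/
def IsGeodesic (g : RiemannianMetricOn n M) (γ : ℝ → M) : Prop :=
  ContMDiff 𝓘(ℝ, ℝ) (𝓡 n) ∞ γ ∧
    ∀ e ∈ IsManifold.maximalAtlas (𝓡 n) ∞ M, ∀ t : ℝ, γ t ∈ e.source →
      ∀ i : Fin n, covariantAcceleration g e γ i t = 0

end Riemannian

/-! ### Lie groups: left-invariant fields, bi-invariant metrics, the exponential map -/

section Lie

variable {n : ℕ} {G : Type*} [TopologicalSpace G] [ChartedSpace (EuclideanSpace ℝ (Fin n)) G]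
  [Group G]

/-- A vector field `X` on `G` is left-invariant if `X (a b) = T_b L_a (X b)` for all `a`, `b`. -/
def IsLeftInvariantField (X : ∀ a : G, TangentSpace (𝓡 n) a) : Prop :=
  ∀ a b : G, X (a * b) = mfderiv (𝓡 n) (𝓡 n) (fun c : G => a * c) b (X b)

variable [LieGroup (𝓡 n) ∞ G]

/-- A metric is left-invariant if every left translation is an isometry. -/
def IsLeftInvariantMetric (g : RiemannianMetricOn n G) : Prop :=
  ∀ (a b : G) (v w : TangentSpace (𝓡 n) b),
    g.inner (a * b) (mfderiv (𝓡 n) (𝓡 n) (fun c : G => a * c) b v)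
      (mfderiv (𝓡 n) (𝓡 n) (fun c : G => a * c) b w) = g.inner b v w

/-- A metric is right-invariant if every right translation is an isometry. -/
def IsRightInvariantMetric (g : RiemannianMetricOn n G) : Prop :=
  ∀ (a b : G) (v w : TangentSpace (𝓡 n) b),
    g.inner (b * a) (mfderiv (𝓡 n) (𝓡 n) (fun c : G => c * a) b v)
      (mfderiv (𝓡 n) (𝓡 n) (fun c : G => c * a) b w) = g.inner b v w

/-- A metric is bi-invariant if it is left-invariant and right-invariant. -/
def IsBiInvariantMetric (g : RiemannianMetricOn n G) : Prop :=
  IsLeftInvariantMetric g ∧ IsRightInvariantMetric g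

theorem lieGroup_minSmoothness (n : ℕ) (G : Type*) [TopologicalSpace G]
    [ChartedSpace (EuclideanSpace ℝ (Fin n)) G] [Group G] [LieGroup (𝓡 n) ∞ G] :
    LieGroup (𝓡 n) (minSmoothness ℝ 3) G := by
  rw [minSmoothness_of_isRCLikeNormedField]
  infer_instance

theorem t2Space_lieGroup (n : ℕ) (G : Type*) [TopologicalSpace G]
    [ChartedSpace (EuclideanSpace ℝ (Fin n)) G] [Group G] [LieGroup (𝓡 n) ∞ G] :
    T2Space G := by
  have : IsTopologicalGroup G := topologicalGroup_of_lieGroup (𝓡 n) ∞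
  have : T1Space G := (𝓡 n).t1Space G
  infer_instance

theorem contMDiff_mulInvariantField (v : GroupLieAlgebra (𝓡 n) G) :
    ContMDiff (𝓡 n) (𝓡 n).tangent 1
      (fun a : G => (⟨a, mulInvariantVectorField v a⟩ : TangentBundle (𝓡 n) G)) := by
  have := lieGroup_minSmoothness n G
  refine (contMDiff_mulInvariantVectorField v).of_le ?_
  rw [minSmoothness_of_isRCLikeNormedField]
  exact one_le_two

/-- Left translates of integral curves of a left-invariant field are integral curves. -/
theorem isMIntegralCurveOn_mul_left (v : GroupLieAlgebra (𝓡 n) G) (a : G) {γ : ℝ → G} {s : Set ℝ}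
    (h : IsMIntegralCurveOn γ (mulInvariantVectorField v) s) :
    IsMIntegralCurveOn (fun t => a * γ t) (mulInvariantVectorField v) s := by
  intro t ht
  have hd : ∀ b c : G, MDifferentiableAt (𝓡 n) (𝓡 n) (fun c : G => b * c) c := fun b c =>
    ((contMDiff_mul_left (I := 𝓡 n) (n := ∞) (a := b)).contMDiffAt).mdifferentiableAt (by simp)
  have h1 := (hd a (γ t)).hasMFDerivAt.comp_hasMFDerivWithinAt t (h t ht)
  have h2 : mulInvariantVectorField v (a * γ t) =
      mfderiv (𝓡 n) (𝓡 n) (fun c : G => a * c) (γ t) (mulInvariantVectorField v (γ t)) := by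
    have hc : (fun c : G => a * γ t * c) = (fun c => a * c) ∘ (fun c => γ t * c) := by
      ext c
      simp [mul_assoc]
    have h3 := (hd a (γ t * 1)).hasMFDerivAt.comp (1 : G) (hd (γ t) 1).hasMFDerivAt
    rw [← hc] at h3
    have h4 := congrArg (fun L : EuclideanSpace ℝ (Fin n) →L[ℝ] EuclideanSpace ℝ (Fin n) => L v)
      h3.mfderiv
    have h5 : γ t * 1 = γ t := mul_one _
    rw [h5] at h4
    exact h4
  refine h1.congr_mfderiv ?_
  rw [h2]
  ext1
  exact map_smul (mfderiv (𝓡 n) (𝓡 n) (fun c : G => a * c) (γ t)) (1 : ℝ) _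

/-- Left-invariant fields are complete. -/
theorem exists_integralCurve_one (v : GroupLieAlgebra (𝓡 n) G) :
    ∃ γ : ℝ → G, γ 0 = 1 ∧ IsMIntegralCurve γ (mulInvariantVectorField v) := by
  have := t2Space_lieGroup n G
  obtain ⟨γ, h0, hγ⟩ := exists_isMIntegralCurveAt_of_contMDiffAt_boundaryless (t₀ := 0)
    (contMDiff_mulInvariantField v).contMDiffAt (x₀ := (1 : G))
  obtain ⟨ε, hε, hγ⟩ := isMIntegralCurveAt_iff'.1 hγ
  rw [Real.ball_eq_Ioo] at hγ
  simp only [zero_sub, zero_add] at hγ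
  exact exists_isMIntegralCurve_of_isMIntegralCurveOn (contMDiff_mulInvariantField v) hε
    (fun x => ⟨fun t => x * γ t, by simp [h0], isMIntegralCurveOn_mul_left v x hγ⟩) 1

/-- The flow line `t ↦ Φ(t, X)` from the identity `e` of the left-invariant vector field `X`
with `X e = v`. -/
def oneFlow (v : GroupLieAlgebra (𝓡 n) G) : ℝ → G :=
  Classical.choose (exists_integralCurve_one v)

/-- The exponential map of a Lie group: the time-one value of the flow line from the identity. -/
def lieExp (v : GroupLieAlgebra (𝓡 n) G) : G := oneFlow v 1

theorem oneFlow_zero (v : GroupLieAlgebra (𝓡 n) G) : oneFlow v 0 = 1 :=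
  (Classical.choose_spec (exists_integralCurve_one v)).1

theorem isMIntegralCurve_oneFlow (v : GroupLieAlgebra (𝓡 n) G) :
    IsMIntegralCurve (oneFlow v) (mulInvariantVectorField v) :=
  (Classical.choose_spec (exists_integralCurve_one v)).2

/-- `exp(t v)` is the flow line at time `t`, of the field with value `v` at the identity. -/
theorem lieExp_smul (t : ℝ) (v : GroupLieAlgebra (𝓡 n) G) : lieExp (t • v) = oneFlow v t := by
  have := t2Space_lieGroup n G
  have h := (isMIntegralCurve_oneFlow v).comp_mul t
  have hf : t • mulInvariantVectorField v = mulInvariantVectorField (I := 𝓡 n) (G := G) (t • v) :=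
    (mulInvariantVectorField_smul t v).symm
  rw [hf] at h
  have := isMIntegralCurve_Ioo_eq_of_contMDiff_boundaryless (t₀ := 0)
    (contMDiff_mulInvariantField (t • v)) (isMIntegralCurve_oneFlow (t • v)) h
    (by simp [oneFlow_zero])
  simpa [lieExp] using congrFun this 1

end Lie

end LieGeodesic

end

/-! For `p` in `G`, the map `σ x = p * x⁻¹ * p` fixes `p` and has derivative `-id` there.
Bi-invariance makes it an isometry, since translations reduce the claim at any point to inversion at
the identity, whose derivative is `-id`. If `p = γ t`, the homomorphism law of the flow gives `σ (γ
s) = γ (2t - s)`. The acceleration at `t` is unchanged by reversing time but negated by `σ`, so it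
vanishes.

The naturality of the Levi-Civita connection is replaced by a computation in a chart. Let `φ` be `σ`
in coordinates and `B` its second derivative at the fixed point. Differentiating the isometry
equation once gives `Γ = -B/2` (`two_mul_partial_eq_of_reflection`,
`sum_inv_mul_partial_of_reflection`); differentiating the reversal equation twice gives `c'' = B(c',
c')/2` (`two_mul_deriv_deriv_of_reflection`). The two contributions cancel in
`covariantAcceleration_eq_zero_of_reflection`. -/

namespace LieGeodesic

/-! ### Calculus in coordinates at the fixed point of a reflection -/

section Euclidean

open Filter Topology

variable {n : ℕ}

local notation "𝔼" => EuclideanSpace ℝ (Fin n)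

/-- A local isometry of a metric on `ℝⁿ` that fixes `y` and reverses the vectors at `y` determines
the first derivatives of the metric at `y`. -/
theorem two_mul_partial_eq_of_reflection {h : 𝔼 → Matrix (Fin n) (Fin n) ℝ} {φ : 𝔼 → 𝔼} {y : 𝔼}
    (hd : ∀ i j, DifferentiableAt ℝ (fun z => h z i j) y)
    (hφ : ContDiffAt ℝ 2 φ y) (hy : φ y = y)
    (hφ' : fderiv ℝ φ y = -ContinuousLinearMap.id ℝ 𝔼)
    (hiso : ∀ᶠ z in 𝓝 y, ∀ i j, h z i j =
      ∑ a, ∑ b, (fderiv ℝ φ z (stdVec i)) a * (fderiv ℝ φ z (stdVec j)) b * h (φ z) a b)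
    (i j k : Fin n) :
    2 * fderiv ℝ (fun z => h z i j) y (stdVec k) =
      -(∑ a, fderiv ℝ (fderiv ℝ φ) y (stdVec k) (stdVec i) a * h y a j)
        - ∑ b, fderiv ℝ (fderiv ℝ φ) y (stdVec k) (stdVec j) b * h y i b := by
  have hφ1 : HasFDerivAt φ (-ContinuousLinearMap.id ℝ 𝔼) y :=
    hφ' ▸ (hφ.differentiableAt (by norm_num)).hasFDerivAt
  have hφ2 : HasFDerivAt (fderiv ℝ φ) (fderiv ℝ (fderiv ℝ φ) y) y :=
    ((hφ.fderiv_right (m := 1) (by norm_num)).differentiableAt (by norm_num)).hasFDerivAt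
  have hl : HasDerivAt (fun s : ℝ => y + s • (stdVec k : 𝔼)) (stdVec k) 0 := by
    simpa using ((hasDerivAt_id (0 : ℝ)).smul_const (stdVec k : 𝔼)).const_add y
  have h0 : y + (0 : ℝ) • (stdVec k : 𝔼) = y := by simp
  have hP : ∀ v a, HasDerivAt (fun s : ℝ => (fderiv ℝ φ (y + s • stdVec k) v) a)
      (fderiv ℝ (fderiv ℝ φ) y (stdVec k) v a) 0 := by
    intro v a
    have h1 : HasDerivAt (fun s : ℝ => fderiv ℝ φ (y + s • stdVec k))
        (fderiv ℝ (fderiv ℝ φ) y (stdVec k)) 0 :=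
      HasFDerivAt.comp_hasDerivAt (0 : ℝ) (by rw [h0]; exact hφ2) hl
    have h2 := h1.clm_apply (hasDerivAt_const (0 : ℝ) v)
    have h3 := (EuclideanSpace.proj (𝕜 := ℝ) a).hasFDerivAt.comp_hasDerivAt (0 : ℝ) h2
    exact h3.congr_deriv (by simp)
  have hH : ∀ a b, HasDerivAt (fun s : ℝ => h (φ (y + s • stdVec k)) a b)
      (-fderiv ℝ (fun z => h z a b) y (stdVec k)) 0 := by
    intro a b
    have h1 : HasDerivAt (fun s : ℝ => φ (y + s • stdVec k)) (-stdVec k) 0 := by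
      exact (HasFDerivAt.comp_hasDerivAt (0 : ℝ) (by rw [h0]; exact hφ1) hl).congr_deriv (by simp)
    have h2 := HasFDerivAt.comp_hasDerivAt (x := (0 : ℝ)) (l := fun z => h z a b)
      (l' := fderiv ℝ (fun z => h z a b) y)
      (by rw [h0, hy]; exact (hd a b).hasFDerivAt) h1
    exact h2.congr_deriv (by simp)
  have hL : HasDerivAt (fun s : ℝ => h (y + s • stdVec k) i j)
      (fderiv ℝ (fun z => h z i j) y (stdVec k)) 0 :=
    HasFDerivAt.comp_hasDerivAt (x := (0 : ℝ)) (l := fun z => h z i j)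
      (l' := fderiv ℝ (fun z => h z i j) y) (by rw [h0]; exact (hd i j).hasFDerivAt) hl
  -- Product rule on the right side of `hiso`. Since `Dφ = -id` at `y`, the term differentiating `h
  -- ∘ φ` equals `-∂ₖhᵢⱼ`; moved to the left side it produces the factor 2.
  have hR := HasDerivAt.fun_sum (u := Finset.univ) fun a _ =>
    HasDerivAt.fun_sum (u := Finset.univ) fun b _ =>
      ((hP (stdVec i) a).mul (hP (stdVec j) b)).mul (hH a b)
  have hev : (fun s : ℝ => h (y + s • stdVec k) i j) =ᶠ[𝓝 0] _ :=
    (hl.continuousAt.eventually (h0.symm ▸ hiso)).mono fun s hs => hs i j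
  have key := hL.unique (hR.congr_of_eventuallyEq hev)
  simp only [Pi.mul_apply, h0, hφ', hy, _root_.neg_apply,
    ContinuousLinearMap.id_apply, PiLp.neg_apply, PiLp.single_apply] at key
  simp only [Finset.sum_add_distrib, add_mul, mul_neg, neg_mul, mul_ite, ite_mul, mul_one, one_mul,
    mul_zero, zero_mul, neg_neg, Finset.sum_neg_distrib, Finset.sum_ite_eq',
    Finset.mem_univ, if_true] at key
  rw [Finset.sum_comm] at key
  simp only [Finset.sum_ite_eq', Finset.mem_univ, if_true] at key
  linarith

/-- In the Christoffel combination of the three instances of `hP`, the symmetries of `B` and `h`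
cancel all terms except the two containing `B a j k`. Their sum is `h` applied to a vector, which
`h⁻¹` undoes. -/
theorem sum_inv_mul_partial_of_reflection {h : Matrix (Fin n) (Fin n) ℝ}
    (hs : ∀ i j, h i j = h j i) (hu : IsUnit h.det) {B : Fin n → Fin n → Fin n → ℝ}
    {P : Fin n → Fin n → Fin n → ℝ}
    (hB : ∀ a i j, B a i j = B a j i)
    (hP : ∀ i j k, 2 * P i j k = -(∑ a, B a k i * h a j) - ∑ b, B b k j * h i b)
    (i j k : Fin n) :
    (1 / 2 : ℝ) * ∑ l, h⁻¹ i l * (P j l k + P k l j - P j k l) = -(1 / 2) * B i j k := by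
  have h1 : ∀ l, P j l k + P k l j - P j k l = -(h.mulVec (fun a => B a j k)) l := by
    intro l
    have e1 := hP j l k
    have e2 := hP k l j
    have e3 := hP j k l
    have s1 : ∑ a, B a j k * h a l = ∑ a, B a k j * h a l := by simp only [hB _ j k]
    have s2 : ∑ b, B b k l * h j b = ∑ b, B b l k * h j b := by simp only [hB _ k l]
    have s3 : ∑ b, B b j l * h k b = ∑ b, B b l j * h b k := by simp only [hB _ j l, hs k]
    have s4 : h.mulVec (fun a => B a j k) l = ∑ a, B a j k * h a l := by
      simp only [Matrix.mulVec, dotProduct, hs l, mul_comm]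
    linarith
  have h2 : ∑ l, h⁻¹ i l * (h.mulVec (fun a => B a j k)) l = B i j k := by
    have := congrFun (Matrix.mulVec_mulVec (fun a => B a j k) h⁻¹ h) i
    rw [Matrix.nonsing_inv_mul _ hu, Matrix.one_mulVec] at this
    exact this
  simp only [h1, mul_neg, Finset.sum_neg_distrib, h2]
  ring

/-- A curve that is reversed by `φ` satisfies `2 c'' = D²φ(c', c')` at the fixed point. -/
theorem two_mul_deriv_deriv_of_reflection {φ : 𝔼 → 𝔼} {c : ℝ → 𝔼} {t : ℝ}
    (hφ : ContDiffAt ℝ 2 φ (c t)) (hc : ContDiffAt ℝ 2 c t)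
    (hφ' : fderiv ℝ φ (c t) = -ContinuousLinearMap.id ℝ 𝔼)
    (hrev : ∀ᶠ s in 𝓝 t, φ (c s) = c (2 * t - s)) :
    (2 : ℝ) • deriv (deriv c) t = fderiv ℝ (fderiv ℝ φ) (c t) (deriv c t) (deriv c t) := by
  have hφ2 : HasFDerivAt (fderiv ℝ φ) (fderiv ℝ (fderiv ℝ φ) (c t)) (c t) :=
    ((hφ.fderiv_right (m := 1) (by norm_num)).differentiableAt (by norm_num)).hasFDerivAt
  have hc1 : HasDerivAt c (deriv c t) t := (hc.differentiableAt (by norm_num)).hasDerivAt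
  have hc2 : HasDerivAt (deriv c) (deriv (deriv c) t) t := by
    have : ContDiffAt ℝ 1 (deriv c) t := by
      have := (hc.fderiv_right (m := 1) (by norm_num)).clm_apply
        (contDiffAt_const (c := (1 : ℝ)))
      simpa using this
    exact (this.differentiableAt (by norm_num)).hasDerivAt
  have hr : HasDerivAt (fun s : ℝ => 2 * t - s) (-1) t := by
    simpa using (hasDerivAt_id t).const_sub (2 * t)
  have ht : 2 * t - t = t := by ring
  have hce : ∀ᶠ s in 𝓝 t, DifferentiableAt ℝ c s :=
    (hc.eventually (by simp)).mono fun s hs => hs.differentiableAt (by norm_num)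
  have hφe : ∀ᶠ s in 𝓝 t, DifferentiableAt ℝ φ (c s) :=
    hc1.continuousAt.eventually
      ((hφ.eventually (by simp)).mono fun s hs => hs.differentiableAt (by norm_num))
  have hce' : ∀ᶠ s in 𝓝 t, DifferentiableAt ℝ c (2 * t - s) :=
    hr.continuousAt.eventually (by simpa only [ht] using hce)
  -- The once-differentiated reversal equation is needed on a neighbourhood of `t`, so that it can
  -- be differentiated again.
  have hev : (fun s => fderiv ℝ φ (c s) (deriv c s)) =ᶠ[𝓝 t] fun s => -deriv c (2 * t - s) := by
    filter_upwards [hce, hφe, hce', hrev.eventually_nhds] with s h1 h2 h3 h4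
    have a1 := h2.hasFDerivAt.comp_hasDerivAt s h1.hasDerivAt
    have hr' : HasDerivAt (fun s : ℝ => 2 * t - s) (-1) s := by
      simpa using (hasDerivAt_id s).const_sub (2 * t)
    have a2 := h3.hasDerivAt.scomp s hr'
    simpa using a1.unique (a2.congr_of_eventuallyEq h4)
  have d1 := (hφ2.comp_hasDerivAt t hc1).clm_apply hc2
  have d2 : HasDerivAt (fun s => -deriv c (2 * t - s)) (deriv (deriv c) t) t := by
    exact (HasDerivAt.scomp (g₁ := deriv c) t (by rw [ht]; exact hc2) hr).neg.congr_deriv (by simp)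
  have key := (d1.congr_of_eventuallyEq hev.symm).unique d2
  simp only [Function.comp_apply, hφ', _root_.neg_apply,
    ContinuousLinearMap.id_apply] at key
  rw [two_smul]
  nth_rewrite 1 [← key]
  abel

theorem bilin_apply_eq_sum (B : 𝔼 →L[ℝ] 𝔼 →L[ℝ] 𝔼) (v w : 𝔼) (i : Fin n) :
    B v w i = ∑ j, ∑ k, B (stdVec j) (stdVec k) i * v j * w k := by
  have hv : ∀ v : 𝔼, v = ∑ j, v j • stdVec j := fun v => by
    simpa using ((EuclideanSpace.basisFun (Fin n) ℝ).sum_repr v).symm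
  conv_lhs => rw [hv v, hv w]
  simp only [map_sum, _root_.sum_apply, map_smul, _root_.smul_apply,
    WithLp.ofLp_sum, Finset.sum_apply, smul_eq_mul, WithLp.ofLp_smul, Pi.smul_apply]
  simp only [Finset.mul_sum]
  refine Finset.sum_comm.trans (Finset.sum_congr rfl fun j _ => Finset.sum_congr rfl fun k _ => ?_)
  ring

end Euclidean
-- Smoothness of integral curves; the metric matrix in a chart
section Smooth

variable {n : ℕ} {M : Type*} [TopologicalSpace M] [ChartedSpace (EuclideanSpace ℝ (Fin n)) M]
  [IsManifold (𝓡 n) ∞ M]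

/-- Integral curves of smooth vector fields are smooth. -/
theorem contMDiff_of_isMIntegralCurve {V : ∀ x : M, TangentSpace (𝓡 n) x}
    (hV : ContMDiff (𝓡 n) (𝓡 n).tangent ∞ (fun x => (⟨x, V x⟩ : TangentBundle (𝓡 n) M)))
    {γ : ℝ → M} (hγ : IsMIntegralCurve γ V) : ContMDiff 𝓘(ℝ, ℝ) (𝓡 n) ∞ γ := by
  rw [contMDiff_infty]
  intro k
  -- Bootstrapping: if `γ` is `C^k`, so is its velocity `V ∘ γ`, hence `γ` is `C^(k+1)`.
  induction k with
  | zero => exact contMDiff_zero_iff.2 hγ.continuous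
  | succ k ih =>
    intro t
    set e := chartAt (EuclideanSpace ℝ (Fin n)) (γ t) with he
    have heA : e ∈ IsManifold.maximalAtlas (𝓡 n) ∞ M := IsManifold.chart_mem_maximalAtlas _
    have heA' : ∀ m : ℕ, e ∈ IsManifold.maximalAtlas (𝓡 n) m M :=
      fun m => IsManifold.maximalAtlas_subset_of_le (by exact_mod_cast le_top) heA
    set U : Set ℝ := γ ⁻¹' e.source
    have hU : IsOpen U := e.open_source.preimage hγ.continuous
    have htU : t ∈ U := mem_chart_source _ _
    -- The velocity read in the chart, typed as a map into the fixed model space instead of the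
    -- varying tangent spaces.
    obtain ⟨W, hW⟩ : ∃ W : ℝ → EuclideanSpace ℝ (Fin n),
        ∀ s, W s = mfderiv (𝓡 n) (𝓡 n) e (γ s) (V (γ s)) := ⟨_, fun _ => rfl⟩
    have hd : ∀ s ∈ U, HasDerivAt (fun s => e (γ s)) (W s) s := by
      intro s hs
      have h1 : MDifferentiableAt (𝓡 n) (𝓡 n) e (γ s) :=
        (contMDiffAt_of_mem_maximalAtlas heA hs).mdifferentiableAt (by simp)
      have h2 := h1.hasMFDerivAt.comp s (hγ s)
      have h3 : HasFDerivAt (fun s => e (γ s)) (ContinuousLinearMap.toSpanSingleton ℝ (W s)) s := by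
        refine hasMFDerivAt_iff_hasFDerivAt.1 (h2.congr_mfderiv ?_)
        ext1
        change mfderiv (𝓡 n) (𝓡 n) e (γ s) ((1 : ℝ) • (V (γ s))) = (1 : ℝ) • W s
        rw [one_smul, one_smul, hW]
      exact h3.hasDerivAt.congr_deriv (one_smul ℝ (W s))
    have hs : ContDiffOn ℝ k W U := by
      rw [← contMDiffOn_iff_contDiffOn]
      have h1 : ContMDiffOn (𝓡 n).tangent (𝓡 n).tangent k
          (tangentMapWithin (𝓡 n) (𝓡 n) e e.source) (π _ (TangentSpace (𝓡 n)) ⁻¹' e.source) :=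
        (contMDiffOn_of_mem_maximalAtlas heA).contMDiffOn_tangentMapWithin
          (by exact_mod_cast le_top) e.open_source.uniqueMDiffOn
      have h2 : ContMDiffOn 𝓘(ℝ, ℝ) (𝓡 n).tangent k
          (fun s => (⟨γ s, V (γ s)⟩ : TangentBundle (𝓡 n) M)) U :=
        ((hV.of_le (by exact_mod_cast le_top)).comp ih).contMDiffOn
      have h3 := (contMDiff_snd_tangentBundle_modelSpace (EuclideanSpace ℝ (Fin n))
        𝓘(ℝ, EuclideanSpace ℝ (Fin n)) (n := k)).comp_contMDiffOn (h1.comp h2 fun s hs => hs)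
      refine h3.congr fun s hs => ?_
      rw [hW]
      change _ = mfderivWithin (𝓡 n) (𝓡 n) e e.source (γ s) (V (γ s))
      rw [mfderivWithin_of_isOpen e.open_source hs]
    have hc : ContDiffOn ℝ ((k : ℕ∞ω) + 1) (fun s => e (γ s)) U := by
      rw [contDiffOn_succ_iff_deriv_of_isOpen hU]
      refine ⟨fun s hs => (hd s hs).differentiableAt.differentiableWithinAt, by simp,
        hs.congr fun s hs => (hd s hs).deriv⟩
    have hc' : ContMDiffAt 𝓘(ℝ, ℝ) (𝓡 n) ((k + 1 : ℕ) : ℕ∞ω) (fun s => e (γ s)) t := by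
      push_cast
      exact (hc.contDiffAt (hU.mem_nhds htU)).contMDiffAt
    have hfin := (contMDiffAt_symm_of_mem_maximalAtlas (heA' (k + 1))
      (e.map_source htU)).comp t hc'
    refine hfin.congr_of_eventuallyEq ?_
    filter_upwards [hU.mem_nhds htU] with s hs using (e.left_inv hs).symm

/-- A coordinate field is the tangent map of `e.symm` applied to a constant field on `ℝⁿ`. -/
theorem contMDiffOn_coordVec {e : OpenPartialHomeomorph M (EuclideanSpace ℝ (Fin n))}
    (he : e ∈ IsManifold.maximalAtlas (𝓡 n) ∞ M) (i : Fin n) :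
    ContMDiffOn (𝓡 n) (𝓡 n).tangent ∞
      (fun y => (⟨e.symm y, coordVec e i y⟩ : TangentBundle (𝓡 n) M)) e.target := by
  have h1 : ContMDiffOn (𝓡 n).tangent (𝓡 n).tangent ∞
      (tangentMapWithin (𝓡 n) (𝓡 n) e.symm e.target) (π _ (TangentSpace (𝓡 n)) ⁻¹' e.target) :=
    (contMDiffOn_symm_of_mem_maximalAtlas he).contMDiffOn_tangentMapWithin
      (by simp) e.open_target.uniqueMDiffOn
  have h2 : ContMDiff (𝓡 n) (𝓡 n).tangent ∞ (fun y : EuclideanSpace ℝ (Fin n) =>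
      (⟨y, stdVec i⟩ : TangentBundle (𝓡 n) (EuclideanSpace ℝ (Fin n)))) :=
    contMDiff_vectorSpace_iff_contDiff.2 contDiff_const
  refine (h1.comp h2.contMDiffOn fun s hs => hs).congr fun s hs => ?_
  simp only [Function.comp_def, tangentMapWithin, mfderivWithin_of_isOpen e.open_target hs, coordVec]

theorem contDiffOn_metricMatrix (g : RiemannianMetricOn n M)
    {e : OpenPartialHomeomorph M (EuclideanSpace ℝ (Fin n))}
    (he : e ∈ IsManifold.maximalAtlas (𝓡 n) ∞ M) (i j : Fin n) :
    ContDiffOn ℝ ∞ (fun y => metricMatrix g e y i j) e.target := by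
  rw [← contMDiffOn_iff_contDiffOn]
  have hb : ContMDiffOn (𝓡 n) (𝓡 n) ∞ e.symm e.target := contMDiffOn_symm_of_mem_maximalAtlas he
  have := ContMDiffOn.clm_bundle_apply₂ (F₁ := EuclideanSpace ℝ (Fin n))
    (F₂ := EuclideanSpace ℝ (Fin n)) (E₃ := Bundle.Trivial M ℝ) (g.contMDiff.comp_contMDiffOn hb)
    (contMDiffOn_coordVec he i) (contMDiffOn_coordVec he j)
  intro y hy
  have h := this y hy
  simp only [contMDiffWithinAt_totalSpace] at h
  exact h.2

theorem metricMatrix_symm (g : RiemannianMetricOn n M)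
    (e : OpenPartialHomeomorph M (EuclideanSpace ℝ (Fin n))) (y : EuclideanSpace ℝ (Fin n))
    (i j : Fin n) : metricMatrix g e y i j = metricMatrix g e y j i :=
  g.symm _ _ _

theorem inner_mfderiv_symm_eq_sum (g : RiemannianMetricOn n M)
    (e : OpenPartialHomeomorph M (EuclideanSpace ℝ (Fin n))) (y v w : EuclideanSpace ℝ (Fin n)) :
    g.inner (e.symm y) (mfderiv (𝓡 n) (𝓡 n) e.symm y v) (mfderiv (𝓡 n) (𝓡 n) e.symm y w) =
      ∑ a, ∑ b, v a * w b * metricMatrix g e y a b := by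
  have hv : ∀ v : EuclideanSpace ℝ (Fin n), v = ∑ j, v j • stdVec j := fun v => by
    simpa using ((EuclideanSpace.basisFun (Fin n) ℝ).sum_repr v).symm
  have hL : ∀ v : EuclideanSpace ℝ (Fin n), mfderiv (𝓡 n) (𝓡 n) e.symm y v =
      ∑ j, v j • coordVec e j y := fun v => by
    conv_lhs => rw [hv v]
    erw [map_sum]
    refine Finset.sum_congr rfl fun j _ => ?_
    exact map_smul (mfderiv (𝓡 n) (𝓡 n) e.symm y) (v j) (stdVec j)
  rw [hL, hL]
  simp only [map_sum, _root_.sum_apply, map_smul, _root_.smul_apply, smul_eq_mul,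
    Finset.mul_sum]
  refine Finset.sum_comm.trans (Finset.sum_congr rfl fun j _ => Finset.sum_congr rfl fun k _ => ?_)
  simp only [metricMatrix, Matrix.of_apply]
  ring

/-- A kernel vector of the matrix would yield a nonzero tangent vector of length zero. Invertibility
matters because `⁻¹` on matrices takes the default value 0 at singular ones. -/
theorem isUnit_det_metricMatrix (g : RiemannianMetricOn n M)
    {e : OpenPartialHomeomorph M (EuclideanSpace ℝ (Fin n))}
    (he : e ∈ IsManifold.maximalAtlas (𝓡 n) ∞ M) {y : EuclideanSpace ℝ (Fin n)}
    (hy : y ∈ e.target) : IsUnit (metricMatrix g e y).det := by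
  rw [isUnit_iff_ne_zero]
  intro h0
  obtain ⟨v, hv, hv0⟩ := Matrix.exists_mulVec_eq_zero_iff.2 h0
  have hinj : Function.Injective (mfderiv (𝓡 n) (𝓡 n) e.symm y) := by
    have hmd : e.MDifferentiable (𝓡 n) (𝓡 n) :=
      ⟨(contMDiffOn_of_mem_maximalAtlas he).mdifferentiableOn (by simp),
        (contMDiffOn_symm_of_mem_maximalAtlas he).mdifferentiableOn (by simp)⟩
    exact hmd.symm.mfderiv_injective hy
  have h1 := inner_mfderiv_symm_eq_sum g e y (WithLp.toLp 2 v) (WithLp.toLp 2 v)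
  have h2 : ∑ a, ∑ b, v a * v b * metricMatrix g e y a b = 0 := by
    have : ∀ a, ∑ b, v a * v b * metricMatrix g e y a b =
        v a * (metricMatrix g e y).mulVec v a := by
      intro a
      simp only [Matrix.mulVec, dotProduct, Finset.mul_sum]
      exact Finset.sum_congr rfl fun b _ => by ring
    simp [this, hv0]
  rw [h2] at h1
  have h3 : mfderiv (𝓡 n) (𝓡 n) e.symm y (WithLp.toLp 2 v) ≠ 0 := by
    intro h
    have h4 : (WithLp.toLp 2 v : EuclideanSpace ℝ (Fin n)) = 0 :=
      hinj (h.trans (map_zero (mfderiv (𝓡 n) (𝓡 n) e.symm y)).symm)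
    exact hv (by simpa using h4)
  exact (g.pos _ _ h3).ne' h1

end Smooth
-- Pulled-back metrics; a reflection forces the acceleration to vanish
section Pullback

open Filter Topology

variable {n : ℕ} {M : Type*} [TopologicalSpace M] [ChartedSpace (EuclideanSpace ℝ (Fin n)) M]
  [IsManifold (𝓡 n) ∞ M]
  {N : Type*} [TopologicalSpace N] [ChartedSpace (EuclideanSpace ℝ (Fin n)) N]
  {N' : Type*} [TopologicalSpace N'] [ChartedSpace (EuclideanSpace ℝ (Fin n)) N']

/-- The pullback of a Riemannian metric by a map. -/
noncomputable def pullbackInner (g : RiemannianMetricOn n M) (f : N → M) (x : N)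
    (v w : EuclideanSpace ℝ (Fin n)) : ℝ :=
  g.inner (f x) (mfderiv (𝓡 n) (𝓡 n) f x v) (mfderiv (𝓡 n) (𝓡 n) f x w)

theorem pullbackInner_congr (g : RiemannianMetricOn n M) {f f' : N → M} {x : N}
    (h : f =ᶠ[𝓝 x] f') : pullbackInner g f x = pullbackInner g f' x := by
  -- The fibres over `p` and `q` are different types; viewing both forms on the model space makes
  -- them comparable.
  have hinner : ∀ p q : M, p = q → ∀ v w : EuclideanSpace ℝ (Fin n),
      (g.inner p : EuclideanSpace ℝ (Fin n) →L[ℝ] EuclideanSpace ℝ (Fin n) →L[ℝ] ℝ) v w =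
        (g.inner q : EuclideanSpace ℝ (Fin n) →L[ℝ] EuclideanSpace ℝ (Fin n) →L[ℝ] ℝ) v w := by
    rintro p _ rfl v w
    rfl
  have hd : (mfderiv (𝓡 n) (𝓡 n) f x : EuclideanSpace ℝ (Fin n) →L[ℝ] EuclideanSpace ℝ (Fin n)) =
    mfderiv (𝓡 n) (𝓡 n) f' x := h.mfderiv_eq
  ext v w
  refine (hinner _ _ h.eq_of_nhds _ _).trans ?_
  exact congrArg (fun L : EuclideanSpace ℝ (Fin n) →L[ℝ] EuclideanSpace ℝ (Fin n) =>
    (g.inner (f' x) : EuclideanSpace ℝ (Fin n) →L[ℝ] EuclideanSpace ℝ (Fin n) →L[ℝ] ℝ)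
      (L v) (L w)) hd

theorem pullbackInner_comp (g : RiemannianMetricOn n M) {f : N → M} {h : N' → N} {x : N'}
    {L : EuclideanSpace ℝ (Fin n) →L[ℝ] EuclideanSpace ℝ (Fin n)}
    (hf : MDifferentiableAt (𝓡 n) (𝓡 n) f (h x)) (hh : HasMFDerivAt (𝓡 n) (𝓡 n) h x L)
    (v w : EuclideanSpace ℝ (Fin n)) :
    pullbackInner g (f ∘ h) x v w = pullbackInner g f (h x) (L v) (L w) := by
  simp only [pullbackInner, (hf.hasMFDerivAt.comp x hh).mfderiv]
  rfl

theorem pullbackInner_id (g : RiemannianMetricOn n M) (x : M) (v w : EuclideanSpace ℝ (Fin n)) :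
    pullbackInner g id x v w = g.inner x v w := by
  simp only [pullbackInner, mfderiv_id]
  rfl

/-- The composition of maps that preserve the metric at a point and at its image. -/
theorem pullbackInner_comp_eq (g : RiemannianMetricOn n M) {f h : M → M} {x : M}
    (hf : MDifferentiableAt (𝓡 n) (𝓡 n) f (h x)) (hh : MDifferentiableAt (𝓡 n) (𝓡 n) h x)
    (hf' : pullbackInner g f (h x) = pullbackInner g id (h x))
    (hh' : pullbackInner g h x = pullbackInner g id x) :
    pullbackInner g (f ∘ h) x = pullbackInner g id x := by
  ext v w
  rw [pullbackInner_comp g hf hh.hasMFDerivAt, hf', ← hh', pullbackInner_id]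
  rfl

/-- If a local isometry `σ` fixes a point of a smooth curve, has derivative `-id` there and
reverses the curve, then the covariant acceleration of the curve vanishes at that point. -/
theorem covariantAcceleration_eq_zero_of_reflection (g : RiemannianMetricOn n M)
    {e : OpenPartialHomeomorph M (EuclideanSpace ℝ (Fin n))}
    (he : e ∈ IsManifold.maximalAtlas (𝓡 n) ∞ M) {γ : ℝ → M}
    (hγ : ContMDiff 𝓘(ℝ, ℝ) (𝓡 n) ∞ γ) {t : ℝ} (ht : γ t ∈ e.source) {σ : M → M}
    (hσ : ContMDiff (𝓡 n) (𝓡 n) ∞ σ) (hiso : ∀ x, pullbackInner g σ x = pullbackInner g id x)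
    (hfix : σ (γ t) = γ t)
    (hσ' : HasMFDerivAt (𝓡 n) (𝓡 n) σ (γ t)
      (-ContinuousLinearMap.id ℝ (EuclideanSpace ℝ (Fin n))))
    (hrev : ∀ s, σ (γ s) = γ (2 * t - s)) (i : Fin n) :
    covariantAcceleration g e γ i t = 0 := by
  set y := e (γ t) with hy
  have hyt : y ∈ e.target := e.map_source ht
  have hys : e.symm y = γ t := e.left_inv ht
  set φ : EuclideanSpace ℝ (Fin n) → EuclideanSpace ℝ (Fin n) := fun z => e (σ (e.symm z)) with hφ
  have hφy : φ y = y := by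
    change e (σ (e.symm y)) = y
    rw [hys, hfix]
  have hes : ∀ z ∈ e.target, ContMDiffAt (𝓡 n) (𝓡 n) ∞ e.symm z := fun z hz =>
    contMDiffAt_symm_of_mem_maximalAtlas he hz
  have hed : ∀ x ∈ e.source, ContMDiffAt (𝓡 n) (𝓡 n) ∞ e x := fun z hz =>
    contMDiffAt_of_mem_maximalAtlas he hz
  have hφs : ContDiffAt ℝ ∞ φ y := by
    refine ContMDiffAt.contDiffAt ?_
    refine ContMDiffAt.comp (I' := 𝓡 n) y (g := e) (f := fun z => σ (e.symm z)) ?_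
      ((hσ _).comp y (hes y hyt))
    exact hed _ (by rw [hys, hfix]; exact ht)
  have hφ2 : ContDiffAt ℝ 2 φ y := hφs.of_le ENat.LEInfty.out
  have hφ' : fderiv ℝ φ y = -ContinuousLinearMap.id ℝ (EuclideanSpace ℝ (Fin n)) := by
    obtain ⟨D, hD⟩ : ∃ D : EuclideanSpace ℝ (Fin n) →L[ℝ] EuclideanSpace ℝ (Fin n),
        HasMFDerivAt (𝓡 n) (𝓡 n) e (γ t) D :=
      ⟨_, ((hed _ ht).mdifferentiableAt (by simp)).hasMFDerivAt⟩
    obtain ⟨D', hD'⟩ : ∃ D : EuclideanSpace ℝ (Fin n) →L[ℝ] EuclideanSpace ℝ (Fin n),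
        HasMFDerivAt (𝓡 n) (𝓡 n) e.symm y D :=
      ⟨_, ((hes _ hyt).mdifferentiableAt (by simp)).hasMFDerivAt⟩
    have h1 : HasFDerivAt (e ∘ e.symm) (D ∘L D') y :=
      hasMFDerivAt_iff_hasFDerivAt.1 (HasMFDerivAt.comp y (by rw [hys]; exact hD) hD')
    -- Conjugation by the chart keeps the derivative: `D ∘ (-id) ∘ D' = -id`.
    have h2 : D ∘L D' = ContinuousLinearMap.id ℝ _ :=
      h1.unique ((hasFDerivAt_id y).congr_of_eventuallyEq (e.eventually_right_inverse hyt))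
    have h3 : HasMFDerivAt (𝓡 n) (𝓡 n) (σ ∘ e.symm) y
        ((-ContinuousLinearMap.id ℝ (EuclideanSpace ℝ (Fin n))) ∘L D') :=
      HasMFDerivAt.comp y (by rw [hys]; exact hσ') hD'
    have hσy : γ t = (σ ∘ e.symm) y := by rw [Function.comp_apply, hys, hfix]
    have h4 : HasFDerivAt φ
        (D ∘L ((-ContinuousLinearMap.id ℝ (EuclideanSpace ℝ (Fin n))) ∘L D')) y :=
      hasMFDerivAt_iff_hasFDerivAt.1
        (HasMFDerivAt.comp y (f := σ ∘ e.symm) (hσy ▸ hD) h3)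
    rw [h4.fderiv, ContinuousLinearMap.neg_comp, ContinuousLinearMap.id_comp,
      ContinuousLinearMap.comp_neg, h2]
  have hmetric : ∀ᶠ z in 𝓝 y, ∀ i j, metricMatrix g e z i j =
      ∑ a, ∑ b, (fderiv ℝ φ z (stdVec i)) a * (fderiv ℝ φ z (stdVec j)) b *
        metricMatrix g e (φ z) a b := by
    have hcont : ContinuousAt (fun z => σ (e.symm z)) y :=
      ((hσ _).comp y (hes y hyt)).continuousAt
    have hsrc : ∀ᶠ z in 𝓝 y, σ (e.symm z) ∈ e.source :=
      hcont.eventually_mem (e.open_source.mem_nhds (by rw [hys, hfix]; exact ht))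
    have htgt : ∀ᶠ z in 𝓝 y, z ∈ e.target := e.open_target.mem_nhds hyt
    filter_upwards [hsrc.eventually_nhds, htgt, hφ2.eventually (by simp)] with z h1 h2 h3 i j
    -- Pulling the metric back along the two sides of this identity gives the right and left sides
    -- of the isometry equation in coordinates.
    have h4 : e.symm ∘ φ =ᶠ[𝓝 z] σ ∘ e.symm := h1.mono fun z hz => e.left_inv hz
    have hφz : HasMFDerivAt (𝓡 n) (𝓡 n) φ z (fderiv ℝ φ z) :=
      (h3.differentiableAt (by norm_num)).hasFDerivAt.hasMFDerivAt
    obtain ⟨L, hL⟩ : ∃ D : EuclideanSpace ℝ (Fin n) →L[ℝ] EuclideanSpace ℝ (Fin n),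
        HasMFDerivAt (𝓡 n) (𝓡 n) e.symm z D :=
      ⟨_, ((hes z h2).mdifferentiableAt (by simp)).hasMFDerivAt⟩
    have heφ : MDifferentiableAt (𝓡 n) (𝓡 n) e.symm (φ z) :=
      (hes _ (e.map_source h1.self_of_nhds)).mdifferentiableAt (by simp)
    have h5 := congrFun (congrFun (pullbackInner_congr g h4) (stdVec i)) (stdVec j)
    rw [pullbackInner_comp g heφ hφz, pullbackInner_comp g ((hσ _).mdifferentiableAt (by simp)) hL,
      hiso, ← pullbackInner_comp g mdifferentiableAt_id hL] at h5
    exact h5.symm.trans (inner_mfderiv_symm_eq_sum g e (φ z) _ _)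
  set c : ℝ → EuclideanSpace ℝ (Fin n) := fun s => e (γ s) with hc
  have hcs : ContDiffAt ℝ 2 c t :=
    ((hed _ ht).comp t (hγ t)).contDiffAt.of_le ENat.LEInfty.out
  have hcrev : ∀ᶠ s in 𝓝 t, φ (c s) = c (2 * t - s) := by
    filter_upwards [hγ.continuous.continuousAt.eventually_mem (e.open_source.mem_nhds ht)] with s hs
    simp only [hφ, hc, e.left_inv hs, hrev]
  have hacc := two_mul_deriv_deriv_of_reflection (c := c) hφ2 hcs hφ' hcrev
  have hpart := two_mul_partial_eq_of_reflection (h := metricMatrix g e)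
    (fun i j => ((contDiffOn_metricMatrix g he i j).contDiffAt
      (e.open_target.mem_nhds hyt)).differentiableAt (by simp))
    hφ2 hφy hφ' hmetric
  -- The symmetry of second derivatives supplies the hypothesis `hB` on the lower indices.
  have hsymm : ∀ u v, fderiv ℝ (fderiv ℝ φ) y u v = fderiv ℝ (fderiv ℝ φ) y v u :=
    hφ2.isSymmSndFDerivAt (by simp [minSmoothness_of_isRCLikeNormedField])
  have hchr : ∀ i j k, christoffel g e i j k y =
      -(1 / 2) * fderiv ℝ (fderiv ℝ φ) y (stdVec j) (stdVec k) i :=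
    sum_inv_mul_partial_of_reflection (P := fun i j k => metricPartial g e i j k y)
      (B := fun i j k => fderiv ℝ (fderiv ℝ φ) y (stdVec j) (stdVec k) i)
      (metricMatrix_symm g e y) (isUnit_det_metricMatrix g he hyt)
      (fun a i j => by rw [hsymm]) (fun i j k => hpart i j k)
  have hd1 : ∀ j, (fun s => deriv (fun s => e (γ s) j) s) =ᶠ[𝓝 t] fun s => deriv c s j := by
    intro j
    filter_upwards [hcs.eventually (by simp)] with s hs
    have h1 : HasDerivAt c (deriv c s) s := (hs.differentiableAt (by norm_num)).hasDerivAt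
    exact ((EuclideanSpace.proj (𝕜 := ℝ) j).hasFDerivAt.comp_hasDerivAt s h1).deriv
  have hd2 : deriv (deriv fun s => e (γ s) i) t = deriv (deriv c) t i := by
    have h1 : HasDerivAt (deriv c) (deriv (deriv c) t) t := by
      have h2 : ContDiffAt ℝ 1 (deriv c) t := by
        simpa using (hcs.fderiv_right (m := 1) (by norm_num)).clm_apply
          (contDiffAt_const (c := (1 : ℝ)))
      exact (h2.differentiableAt (by norm_num)).hasDerivAt
    exact (hd1 i).deriv_eq.trans
      ((EuclideanSpace.proj (𝕜 := ℝ) i).hasFDerivAt.comp_hasDerivAt t h1).deriv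
  have hd1' : ∀ j, deriv (fun s => e (γ s) j) t = deriv c t j := fun j => (hd1 j).eq_of_nhds
  have h2 : 2 * deriv (deriv c) t i =
      fderiv ℝ (fderiv ℝ φ) y (deriv c t) (deriv c t) i := by
    simpa using congrArg (fun v : EuclideanSpace ℝ (Fin n) => v i) hacc
  rw [bilin_apply_eq_sum] at h2
  unfold covariantAcceleration
  rw [← hy, hd2]
  simp only [hd1', hchr, mul_assoc, ← Finset.mul_sum] at h2 ⊢
  linarith

end Pullback

/-! ### Inversion symmetries and one-parameter subgroups of a Lie group -/

section Group

open Filter Topology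

variable {n : ℕ} {G : Type*} [TopologicalSpace G] [ChartedSpace (EuclideanSpace ℝ (Fin n)) G]
  [Group G] [LieGroup (𝓡 n) ∞ G]

/-- The geodesic symmetry `x ↦ p x⁻¹ p` of a Lie group at `p`. -/
def groupReflection {G : Type*} [Group G] (p x : G) : G := p * x⁻¹ * p

theorem contMDiff_groupReflection (p : G) :
    ContMDiff (𝓡 n) (𝓡 n) ∞ (groupReflection p) :=
  (contMDiff_const.mul (contMDiff_inv (𝓡 n) ∞)).mul contMDiff_const

theorem groupReflection_self {G : Type*} [Group G] (p : G) : groupReflection p p = p := by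
  simp [groupReflection]

theorem hasMFDerivAt_groupReflection (p : G) :
    HasMFDerivAt (𝓡 n) (𝓡 n) (groupReflection p) p
      (-ContinuousLinearMap.id ℝ (EuclideanSpace ℝ (Fin n))) := by
  -- `F` is the multiplication for which `p` is the unit, and `F (groupReflection p x, x) = p` is
  -- constant. Both partial derivatives of `F` at `(p, p)` are the identity, so differentiating
  -- gives `D + id = 0`.
  let F : G × G → G := fun q => q.1 * p⁻¹ * q.2
  have hF : ContMDiff ((𝓡 n).prod (𝓡 n)) (𝓡 n) ∞ F :=
    (contMDiff_fst.mul contMDiff_const).mul contMDiff_snd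
  obtain ⟨D, hD⟩ : ∃ D : EuclideanSpace ℝ (Fin n) →L[ℝ] EuclideanSpace ℝ (Fin n),
      HasMFDerivAt (𝓡 n) (𝓡 n) (groupReflection p) p D :=
    ⟨_, ((contMDiff_groupReflection p p).mdifferentiableAt (by simp)).hasMFDerivAt⟩
  have hFd : MDifferentiableAt ((𝓡 n).prod (𝓡 n)) (𝓡 n) F (p, p) :=
    (hF _).mdifferentiableAt (by simp)
  have h1 : HasMFDerivAt (𝓡 n) (𝓡 n) (fun x => F (groupReflection p x, x)) p
      ((mfderiv ((𝓡 n).prod (𝓡 n)) (𝓡 n) F (p, p)).comp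
        (D.prod (ContinuousLinearMap.id ℝ (EuclideanSpace ℝ (Fin n))))) := by
    refine HasMFDerivAt.comp (g := F) p ?_ (hD.prodMk (hasMFDerivAt_id p))
    rw [groupReflection_self]
    exact hFd.hasMFDerivAt
  have h2 : (fun x => F (groupReflection p x, x)) = fun _ => p := by
    ext x
    simp [F, groupReflection]
  rw [h2] at h1
  have h3 := hasMFDerivAt_unique h1 (hasMFDerivAt_const p p)
  have hD' : D = -ContinuousLinearMap.id ℝ (EuclideanSpace ℝ (Fin n)) := by
    ext1 v
    have h4 := congrArg (fun L : EuclideanSpace ℝ (Fin n) →L[ℝ] EuclideanSpace ℝ (Fin n) => L v) h3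
    have h5 := mfderiv_prod_eq_add_apply (v := (D v, v)) hFd
    have e1 : (fun z : G => F (z, p)) = id := by ext; simp [F]
    have e2 : (fun z : G => F (p, z)) = id := by ext; simp [F]
    have d1 : mfderiv (𝓡 n) (𝓡 n) (fun z : G => F (z, p)) p (D v) = D v :=
      (DFunLike.congr_fun (hasMFDerivAt_id p |>.congr_of_eventuallyEq
        (Filter.Eventually.of_forall fun z => congrFun e1 z)).mfderiv (D v))
    have d2 : mfderiv (𝓡 n) (𝓡 n) (fun z : G => F (p, z)) p v = v :=
      (DFunLike.congr_fun (hasMFDerivAt_id p |>.congr_of_eventuallyEq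
        (Filter.Eventually.of_forall fun z => congrFun e2 z)).mfderiv v)
    refine eq_neg_of_add_eq_zero_left (Eq.trans ?_ (h5.symm.trans h4))
    exact congrArg₂ (fun a b : EuclideanSpace ℝ (Fin n) => a + b) d1.symm d2.symm
  rwa [hD'] at hD

/-- Inversion is the reflection at 1, with derivative `-id` there, and a bilinear form does not see
the sign. -/
theorem pullbackInner_inv_one (m : RiemannianMetricOn n G) :
    pullbackInner m (fun x : G => x⁻¹) 1 = pullbackInner m id 1 := by
  have h : HasMFDerivAt (𝓡 n) (𝓡 n) (fun x : G => x⁻¹) 1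
      (-ContinuousLinearMap.id ℝ (EuclideanSpace ℝ (Fin n))) := by
    have h1 := hasMFDerivAt_groupReflection (n := n) (1 : G)
    have h2 : groupReflection (1 : G) = fun x => x⁻¹ := by ext; simp [groupReflection]
    rwa [h2] at h1
  have hinner : ∀ q : G, q = 1 → ∀ v w : EuclideanSpace ℝ (Fin n),
      (m.inner q : EuclideanSpace ℝ (Fin n) →L[ℝ] EuclideanSpace ℝ (Fin n) →L[ℝ] ℝ) (-v) (-w) =
        (m.inner 1 : EuclideanSpace ℝ (Fin n) →L[ℝ] EuclideanSpace ℝ (Fin n) →L[ℝ] ℝ) v w := by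
    have hneg : ∀ (B : EuclideanSpace ℝ (Fin n) →L[ℝ] EuclideanSpace ℝ (Fin n) →L[ℝ] ℝ) (v w),
        B (-v) (-w) = B v w := by simp
    rintro q rfl v w
    exact hneg _ v w
  ext v w
  rw [pullbackInner_id]
  refine Eq.trans ?_ (hinner 1⁻¹ inv_one v w)
  simp only [pullbackInner, h.mfderiv]
  rfl

theorem pullbackInner_groupReflection {m : RiemannianMetricOn n G} (hm : IsBiInvariantMetric m)
    (p x : G) : pullbackInner m (groupReflection p) x = pullbackInner m id x := by
  have hl : ∀ a b : G, pullbackInner m (fun c : G => a * c) b = pullbackInner m id b := by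
    intro a b
    ext v w
    rw [pullbackInner_id]
    exact hm.1 a b v w
  have hr : ∀ a b : G, pullbackInner m (fun c : G => c * a) b = pullbackInner m id b := by
    intro a b
    ext v w
    rw [pullbackInner_id]
    exact hm.2 a b v w
  have dl : ∀ a : G, ContMDiff (𝓡 n) (𝓡 n) ∞ fun c : G => a * c := fun a => contMDiff_mul_left
  have dr : ∀ a : G, ContMDiff (𝓡 n) (𝓡 n) ∞ fun c : G => c * a := fun a => contMDiff_mul_right
  have di : ContMDiff (𝓡 n) (𝓡 n) ∞ fun c : G => c⁻¹ := contMDiff_inv (𝓡 n) ∞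
  have hd : ∀ {f : G → G}, ContMDiff (𝓡 n) (𝓡 n) ∞ f → ∀ x, MDifferentiableAt (𝓡 n) (𝓡 n) f x :=
    fun hf x => (hf x).mdifferentiableAt (by simp)
  have hi : pullbackInner m (fun c : G => c⁻¹) (x⁻¹ * x) = pullbackInner m id (x⁻¹ * x) := by
    rw [inv_mul_cancel]
    exact pullbackInner_inv_one m
  have h1 := pullbackInner_comp_eq m (hd di _) (hd (dl x⁻¹) x) hi (hl _ _)
  have h2 := pullbackInner_comp_eq m (hd (dr (x⁻¹ * p)) _) (hd (di.comp (dl x⁻¹)) x) (hr _ _) h1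
  have h3 := pullbackInner_comp_eq m (hd (dl p) _)
    (hd ((dr (x⁻¹ * p)).comp (di.comp (dl x⁻¹))) x) (hl _ _) h2
  -- The factorization depends on `x`: the inner translation carries `x` to 1, the one point where
  -- inversion is known to preserve the metric.
  have h4 : groupReflection p = (fun c : G => p * c) ∘ (fun c : G => c * (x⁻¹ * p)) ∘
      (fun c : G => c⁻¹) ∘ fun c : G => x⁻¹ * c := by
    ext c
    simp [groupReflection, mul_assoc]
  rw [h4]
  exact h3

/-- Left-invariant vector fields are smooth. -/
theorem contMDiff_infty_mulInvariantVectorField (v : GroupLieAlgebra (𝓡 n) G) :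
    ContMDiff (𝓡 n) (𝓡 n).tangent ∞
      (fun a : G => (⟨a, mulInvariantVectorField v a⟩ : TangentBundle (𝓡 n) G)) := by
  have hm : ContMDiff ((𝓡 n).prod (𝓡 n)) (𝓡 n) ∞ fun p : G × G => p.1 * p.2 :=
    contMDiff_mul (𝓡 n) ∞
  have h0 : ContMDiff (𝓡 n) (𝓡 n).tangent ∞ fun a : G =>
      (TotalSpace.mk' (EuclideanSpace ℝ (Fin n)) a 0 : TangentBundle (𝓡 n) G) :=
    contMDiff_zeroSection _ _
  have hv : ContMDiff (𝓡 n) (𝓡 n).tangent ∞ fun _ : G =>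
      (TotalSpace.mk' (EuclideanSpace ℝ (Fin n)) 1 v : TangentBundle (𝓡 n) G) :=
    contMDiff_const
  have h2 : ContMDiff ((𝓡 n).tangent.prod (𝓡 n).tangent) ((𝓡 n).prod (𝓡 n)).tangent ∞
      (equivTangentBundleProd (𝓡 n) G (𝓡 n) G).symm := contMDiff_equivTangentBundleProd_symm
  have h3 : ContMDiff ((𝓡 n).prod (𝓡 n)).tangent (𝓡 n).tangent ∞
      (tangentMap ((𝓡 n).prod (𝓡 n)) (𝓡 n) fun p : G × G => p.1 * p.2) :=
    hm.contMDiff_tangentMap (by simp)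
  -- The field at `a` is the derivative of multiplication at `(a, 1)` applied to `(0, v)`, so it
  -- inherits smoothness from the tangent map of multiplication.
  refine ((h3.comp h2).comp (h0.prodMk hv)).congr fun a => ?_
  have h4 := mfderiv_prod_eq_add_apply (v := ((0 : EuclideanSpace ℝ (Fin n)), (id v : EuclideanSpace ℝ (Fin n))))
    ((hm (a, 1)).mdifferentiableAt (by simp))
  have hmk : ∀ (b c : G) (u w : EuclideanSpace ℝ (Fin n)), b = c → u = w →
      (⟨b, u⟩ : TangentBundle (𝓡 n) G) = ⟨c, w⟩ := by
    rintro b _ u _ rfl rfl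
    rfl
  refine hmk _ _ _ _ (mul_one a).symm (h4.trans ?_).symm
  exact (congrArg₂ (fun u w : EuclideanSpace ℝ (Fin n) => u + w)
    (map_zero (mfderiv (𝓡 n) (𝓡 n) (fun z : G => z * 1) a)) rfl).trans (zero_add _)

/-- As functions of `t`, both sides are integral curves of the same field and agree at 0. -/
theorem oneFlow_add (v : GroupLieAlgebra (𝓡 n) G) (s t : ℝ) :
    oneFlow v (s + t) = oneFlow v s * oneFlow v t := by
  have := t2Space_lieGroup n G
  have h1 := (isMIntegralCurve_oneFlow v).comp_add s
  have h2 : IsMIntegralCurve (fun t => oneFlow v s * oneFlow v t) (mulInvariantVectorField v) :=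
    isMIntegralCurve_iff_isMIntegralCurveOn.2 (isMIntegralCurveOn_mul_left v (oneFlow v s)
      ((isMIntegralCurve_oneFlow v).isMIntegralCurveOn Set.univ))
  have h3 := isMIntegralCurve_Ioo_eq_of_contMDiff_boundaryless (t₀ := 0)
    (contMDiff_mulInvariantField v) h1 h2 (by simp [oneFlow_zero])
  simpa [add_comm] using congrFun h3 t

theorem groupReflection_mul_oneFlow (v : GroupLieAlgebra (𝓡 n) G) (g : G) (s t : ℝ) :
    groupReflection (g * oneFlow v t) (g * oneFlow v s) = g * oneFlow v (2 * t - s) := by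
  have h1 : oneFlow v t = oneFlow v (t - s) * oneFlow v s := by
    rw [← oneFlow_add, sub_add_cancel]
  have h2 : oneFlow v (2 * t - s) = oneFlow v (t - s) * oneFlow v t := by
    rw [← oneFlow_add]
    congr 1
    ring
  rw [h2, groupReflection]
  nth_rewrite 1 [h1]
  group

end Group

end LieGeodesic

theorem mainTheorem9 {n : ℕ} {G : Type*} [TopologicalSpace G]
    [ChartedSpace (EuclideanSpace ℝ (Fin n)) G] [Group G] [LieGroup (𝓡 n) ∞ G]
    (m : LieGeodesic.RiemannianMetricOn n G) (hm : LieGeodesic.IsBiInvariantMetric m)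
    (X : ∀ a : G, TangentSpace (𝓡 n) a) (hX : LieGeodesic.IsLeftInvariantField X) (g : G) :
    g * LieGeodesic.lieExp ((0 : ℝ) • X 1) = g ∧
      LieGeodesic.IsGeodesic m (fun t : ℝ => g * LieGeodesic.lieExp (t • X 1)) := by
  have hexp : ∀ t : ℝ, LieGeodesic.lieExp (t • X 1) = LieGeodesic.oneFlow (X 1) t := fun t =>
    LieGeodesic.lieExp_smul t (X 1)
  simp only [hexp, LieGeodesic.oneFlow_zero, mul_one, true_and]
  have hsmooth : ContMDiff 𝓘(ℝ, ℝ) (𝓡 n) ∞ fun t : ℝ => g * LieGeodesic.oneFlow (X 1) t :=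
    contMDiff_const.mul (LieGeodesic.contMDiff_of_isMIntegralCurve
      (LieGeodesic.contMDiff_infty_mulInvariantVectorField (X 1))
      (LieGeodesic.isMIntegralCurve_oneFlow (X 1)))
  -- A separate reflection is used for each time `t`, the one centred at the point of the curve at
  -- that time.
  exact ⟨hsmooth, fun e he t ht i =>
    LieGeodesic.covariantAcceleration_eq_zero_of_reflection m he hsmooth ht
      (LieGeodesic.contMDiff_groupReflection _) (LieGeodesic.pullbackInner_groupReflection hm _)
      (LieGeodesic.groupReflection_self _) (LieGeodesic.hasMFDerivAt_groupReflection _)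
      (fun s => LieGeodesic.groupReflection_mul_oneFlow (X 1) g s t) i⟩
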